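/- **Proposition.** Let $p$ be a prime, let $R$ be a complete discrete valuation ring in which $p$ is a uniformizer, and let $K$ be its field of fractions, of characteristic zero. Let $K(\mu_{p^\infty})$ be the extension of $K$ obtained by adjoining all $p$-power roots of unity, let $\Gamma = \mathrm{Gal}(K(\mu_{p^\infty})/K)$, and let $\chi_{\mathrm{cyc}} : \Gamma \to \mathbb{Z}_p^\times$ be the cyclotomic character, so that $\sigma(\zeta) = \zeta^{\chi_{\mathrm{cyc}}(\sigma)}$ for all $\sigma \in \Gamma$ and $\zeta \in \mu_{p^\infty}$. Let $G$ be a pro-$p$ group. An Artin $K$-representation of $G$ is a finite dimensional $K$-linear representation of $G$ on which some open subgroup of $G$ acts trivially; let $\mathcal{A}$ be the category of these representations. Let $K_0(\mathcal{A})$ be its Grothendieck group: the abelian group generated by the isomorphism classes $[\rho]$ of objects of $\mathcal{A}$, subject to $[\rho] = [\rho'] + [\rho'']$ for every short exact sequence $0 \to \rho' \to \rho \to \rho'' \to 0$ in $\mathcal{A}$. It is a commutative ring with multiplication $[\rho][\rho'] = [\rho \otimes_K \rho']$. Let $G$ act on itself by conjugation, and let $\Gamma$ act on the set $G$ by $\sigma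 . g = g^{\chi_{\mathrm{cyc}}(\sigma)}$. These actions commute. Let $C^\infty(G,K)^{G\times\Gamma}$ be the $K$-algebra of locally constant functions $f : G \to K$ that are invariant under $G \times \Gamma$, which acts by $(a.f)(x) = f(a^{-1}.x)$. Then there is an isomorphism of $K$-algebras \[ \chi : K \otimes_{\mathbb{Z}} K_0(\mathcal{A}) \longrightarrow C^\infty(G,K)^{G \times \Gamma}, \qquad \chi(\lambda \otimes [\rho])(g) = \lambda \cdot \mathrm{tr}\,\rho(g) \quad (\lambda \in K,\ \rho \in \mathcal{A},\ g \in G). \] -/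

import Mathlib

open CategoryTheory MonoidalCategory Filter Topology
open scoped TensorProduct

noncomputable section

universe u v

/-! ### Pro-`p` groups and `p`-adic powers -/

/-- A profinite group (the topological assumptions are supplied separately as
`[IsTopologicalGroup G] [CompactSpace G] [TotallyDisconnectedSpace G]`) is pro-`p` if its quotient
by every open normal subgroup is a `p`-group. -/
class IsProP (p : ℕ) (G : Type v) [Group G] [TopologicalSpace G] : Prop where
  isPGroup_quotient : ∀ N : OpenNormalSubgroup G, IsPGroup p (G ⧸ N.toSubgroup)

theorem exists_pow_mem {p : ℕ} {G : Type v} [Group G] [TopologicalSpace G] [IsProP p G]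
    (N : OpenNormalSubgroup G) (g : G) :
    ∃ m : ℕ, (g : G ⧸ N.toSubgroup) ^ p ^ m = 1 :=
  IsProP.isPGroup_quotient N _

theorem pow_eq_of_modEq {p : ℕ} {H : Type*} [Group H] {x : H} {m : ℕ} (hx : x ^ p ^ m = 1) {a b : ℕ}
    (hab : a ≡ b [MOD p ^ m]) : x ^ a = x ^ b :=
  pow_eq_pow_iff_modEq.2 (hab.of_dvd (orderOf_dvd_of_pow_eq_one hx))

section PadicPower

variable (p : ℕ) [Fact p.Prime] {G : Type v} [Group G] [TopologicalSpace G]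

/-- The `p`-adic power `g ^ a` of an element of a pro-`p` group: the limit of `g ^ aₙ`, where `aₙ`
is the natural number `< p ^ n` congruent to `a` modulo `p ^ n`. -/
def padicPow (g : G) (a : ℤ_[p]) : G :=
  haveI : Nonempty G := ⟨1⟩
  limUnder atTop (fun n : ℕ => g ^ a.appr n)

variable {p}

theorem appr_modEq {a : ℤ_[p]} {m k : ℕ} (h : (p : ℤ_[p]) ^ m ∣ a - k) :
    a.appr m ≡ k [MOD p ^ m] := by
  have h1 : (p : ℤ_[p]) ^ m ∣ a - a.appr m :=
    Ideal.mem_span_singleton.1 (PadicInt.appr_spec m a)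
  have h2 : (p : ℤ_[p]) ^ m ∣ ((k - a.appr m : ℤ) : ℤ_[p]) := by
    have := dvd_sub h1 h
    push_cast
    simpa using this
  have h3 : ((p ^ m : ℕ) : ℤ) ∣ (k - a.appr m : ℤ) := by
    have := (PadicInt.pow_p_dvd_int_iff m _).1 h2
    exact_mod_cast this
  exact (Nat.modEq_iff_dvd).2 h3

theorem appr_modEq_of_le (a : ℤ_[p]) {m n : ℕ} (h : m ≤ n) :
    a.appr n ≡ a.appr m [MOD p ^ m] :=
  ((Nat.modEq_iff_dvd' (PadicInt.appr_mono a h)).2 (PadicInt.dvd_appr_sub_appr a m n h)).symm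

variable [IsTopologicalGroup G] [CompactSpace G] [TotallyDisconnectedSpace G] [IsProP p G]

theorem tendsto_padicPow (g : G) (a : ℤ_[p]) :
    Tendsto (fun n : ℕ => g ^ a.appr n) atTop (𝓝 (padicPow p g a)) := by
  have : Nonempty G := ⟨1⟩
  refine tendsto_nhds_limUnder ?_
  obtain ⟨x, hx⟩ := exists_clusterPt_of_compactSpace (map (fun n : ℕ => g ^ a.appr n) atTop)
  refine ⟨x, fun s hs => ?_⟩
  obtain ⟨t, hts, hto, hxt⟩ := mem_nhds_iff.1 hs
  obtain ⟨N, hN⟩ := ProfiniteGrp.exist_openNormalSubgroup_sub_open_nhds_of_one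
    (U := (fun y => x * y) ⁻¹' t) (hto.preimage (continuous_const_mul x)) (by simpa using hxt)
  obtain ⟨m, hm⟩ := exists_pow_mem (p := p) N g
  have key : ∀ n, m ≤ n → (g ^ a.appr n : G ⧸ N.toSubgroup) = g ^ a.appr m := fun n hn =>
    pow_eq_of_modEq hm (appr_modEq_of_le a hn)
  have hopen : {y | x⁻¹ * y ∈ (N : Set G)} ∈ 𝓝 x :=
    (N.toOpenSubgroup.isOpen.preimage (continuous_const_mul x⁻¹)).mem_nhds (by
      change x⁻¹ * x ∈ N.toSubgroup
      simp)
  have hfreq : ∃ᶠ n : ℕ in atTop, g ^ a.appr n ∈ {y | x⁻¹ * y ∈ (N : Set G)} :=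
    (mapClusterPt_iff_frequently.1 hx) _ hopen
  obtain ⟨n₀, hmem, hn₀⟩ := (hfreq.and_eventually (eventually_ge_atTop m)).exists
  have hx0 : (x : G ⧸ N.toSubgroup) = g ^ a.appr m := by
    rw [← key n₀ hn₀, ← QuotientGroup.mk_pow]
    exact QuotientGroup.eq.2 hmem
  refine mem_map.2 ((eventually_ge_atTop m).mono fun n hn => hts ?_)
  have h1 : x⁻¹ * g ^ a.appr n ∈ N.toSubgroup := by
    refine QuotientGroup.eq.1 ?_
    rw [hx0, ← key n hn, QuotientGroup.mk_pow]
  have h2 := hN h1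
  simpa using h2

theorem mk_padicPow {N : OpenNormalSubgroup G} {g : G} {m : ℕ}
    (hm : (g : G ⧸ N.toSubgroup) ^ p ^ m = 1) {a : ℤ_[p]} {k : ℕ}
    (hk : (p : ℤ_[p]) ^ m ∣ a - k) :
    (QuotientGroup.mk (padicPow p g a) : G ⧸ N.toSubgroup) = (g : G ⧸ N.toSubgroup) ^ k := by
  have hopen : {y | (padicPow p g a)⁻¹ * y ∈ (N : Set G)} ∈ 𝓝 (padicPow p g a) :=
    (N.toOpenSubgroup.isOpen.preimage (continuous_const_mul _)).mem_nhds (by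
      change (padicPow p g a)⁻¹ * padicPow p g a ∈ N.toSubgroup
      simp)
  obtain ⟨n, hn, hmn⟩ :=
    (((tendsto_padicPow g a).eventually hopen).and (eventually_ge_atTop m)).exists
  have h1 : (QuotientGroup.mk (padicPow p g a) : G ⧸ N.toSubgroup) = ((g ^ a.appr n : G) : G ⧸ N.toSubgroup) :=
    QuotientGroup.eq.2 hn
  rw [h1, QuotientGroup.mk_pow]
  exact pow_eq_of_modEq hm ((appr_modEq_of_le a hmn).trans (appr_modEq hk))

theorem eq_of_forall_mk {x y : G}
    (h : ∀ N : OpenNormalSubgroup G, (x : G ⧸ N.toSubgroup) = y) : x = y := by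
  by_contra hne
  have h1 : (1 : G) ∈ ({x⁻¹ * y}ᶜ : Set G) := by
    intro h1
    exact hne (inv_mul_eq_one.1 (Set.mem_singleton_iff.1 h1).symm)
  obtain ⟨N, hN⟩ := ProfiniteGrp.exist_openNormalSubgroup_sub_open_nhds_of_one
    (isOpen_compl_singleton (x := x⁻¹ * y)) h1
  exact hN (QuotientGroup.eq.1 (h N)) rfl

theorem padicPow_one (g : G) : padicPow p g 1 = g := by
  refine eq_of_forall_mk fun N => ?_
  obtain ⟨m, hm⟩ := exists_pow_mem (p := p) N g
  rw [mk_padicPow hm (k := 1) (by simp), pow_one]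

theorem padicPow_padicPow (g : G) (a b : ℤ_[p]) :
    padicPow p (padicPow p g a) b = padicPow p g (a * b) := by
  refine eq_of_forall_mk fun N => ?_
  obtain ⟨m, hm⟩ := exists_pow_mem (p := p) N g
  have ha : (p : ℤ_[p]) ^ m ∣ a - a.appr m :=
    Ideal.mem_span_singleton.1 (PadicInt.appr_spec m a)
  have hb : (p : ℤ_[p]) ^ m ∣ b - b.appr m :=
    Ideal.mem_span_singleton.1 (PadicInt.appr_spec m b)
  have h1 := mk_padicPow hm ha
  have hm' : (QuotientGroup.mk (padicPow p g a) : G ⧸ N.toSubgroup) ^ p ^ m = 1 := by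
    rw [h1, ← pow_mul, mul_comm, pow_mul, hm, one_pow]
  rw [mk_padicPow hm' hb, h1, ← pow_mul,
    mk_padicPow hm (k := a.appr m * b.appr m)]
  have : a * b - ((a.appr m * b.appr m : ℕ) : ℤ_[p])
      = (a - a.appr m) * b + a.appr m * (b - b.appr m) := by push_cast; ring
  rw [this]
  exact dvd_add (ha.mul_right _) (hb.mul_left _)

theorem conj_padicPow (h g : G) (a : ℤ_[p]) :
    padicPow p (h * g * h⁻¹) a = h * padicPow p g a * h⁻¹ := by
  refine eq_of_forall_mk fun N => ?_
  obtain ⟨m, hm⟩ := exists_pow_mem (p := p) N g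
  have ha : (p : ℤ_[p]) ^ m ∣ a - a.appr m :=
    Ideal.mem_span_singleton.1 (PadicInt.appr_spec m a)
  have hm' : ((h * g * h⁻¹ : G) : G ⧸ N.toSubgroup) ^ p ^ m = 1 := by
    rw [QuotientGroup.mk_mul, QuotientGroup.mk_mul, QuotientGroup.mk_inv, conj_pow, hm]
    simp
  rw [mk_padicPow hm' ha, QuotientGroup.mk_mul, QuotientGroup.mk_mul, QuotientGroup.mk_mul,
    QuotientGroup.mk_mul, QuotientGroup.mk_inv, conj_pow, mk_padicPow hm ha]

end PadicPower

/-! ### The field `K(μ_{p^∞})`, its Galois group and the action of `G × Γ` on `G` -/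

section Cyclotomic

variable (p : ℕ) (K : Type u) [Field K]

/-- The field `K(μ_{p^∞})`, inside an algebraic closure of `K`. -/
abbrev CycloInfty : IntermediateField K (AlgebraicClosure K) :=
  IntermediateField.adjoin K {ζ | ∃ n : ℕ, ζ ^ p ^ n = 1}

/-- `Γ = Gal(K(μ_{p^∞}) / K)`. -/
abbrev CycloGal : Type u := CycloInfty p K ≃ₐ[K] CycloInfty p K

variable [Fact p.Prime]

/-- The cyclotomic character `χ : Γ → ℤ_pˣ`. -/
def cycloChar : CycloGal p K →* ℤ_[p]ˣ :=
  (cyclotomicCharacter (CycloInfty p K) p).comp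
    (MulSemiringAction.toRingAut (CycloGal p K) (CycloInfty p K))

instance hasEnoughRootsOfUnity_cycloInfty [CharZero K] (i : ℕ) :
    HasEnoughRootsOfUnity (CycloInfty p K) (p ^ i) := by
  have hp : p ≠ 0 := (Fact.out : p.Prime).ne_zero
  have : NeZero (p ^ i) := ⟨pow_ne_zero _ hp⟩
  have : CharZero (AlgebraicClosure K) := charZero_of_injective_algebraMap
    (algebraMap K (AlgebraicClosure K)).injective
  have : NeZero ((p ^ i : ℕ) : AlgebraicClosure K) :=
    ⟨by exact_mod_cast pow_ne_zero i hp⟩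
  obtain ⟨ζ, hζ⟩ := HasEnoughRootsOfUnity.exists_primitiveRoot (AlgebraicClosure K) (p ^ i)
  have hmem : ζ ∈ CycloInfty p K :=
    IntermediateField.subset_adjoin _ _ ⟨i, hζ.pow_eq_one⟩
  refine ⟨⟨⟨ζ, hmem⟩, ?_⟩, rootsOfUnity.isCyclic _ _⟩
  exact IsPrimitiveRoot.of_map_of_injective (f := (CycloInfty p K).val) hζ
    (CycloInfty p K).val.injective

/-- The defining property of the cyclotomic character: `σ ζ = ζ ^ χ(σ)`. -/
theorem cycloChar_spec [CharZero K] (σ : CycloGal p K) (n : ℕ) (ζ : CycloInfty p K)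
    (hζ : ζ ^ p ^ n = 1) :
    σ ζ = ζ ^ ((cycloChar p K σ : ℤ_[p]).toZModPow n).val :=
  cyclotomicCharacter.spec p (MulSemiringAction.toRingAut (CycloGal p K) (CycloInfty p K) σ) ζ hζ

variable (G : Type v) [Group G] [TopologicalSpace G]
  [IsTopologicalGroup G] [CompactSpace G] [TotallyDisconnectedSpace G] [IsProP p G]

/-- The action of `G × Γ` on `G`: `G` acts by conjugation, and `σ ∈ Γ` by `g ↦ g ^ χ(σ)`. -/
@[reducible] def conjCycloAction : MulAction (G × CycloGal p K) G where
  smul a x := a.1 * padicPow p x (cycloChar p K a.2 : ℤ_[p]) * a.1⁻¹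
  one_smul x := by
    change 1 * padicPow p x (cycloChar p K 1 : ℤ_[p]) * 1⁻¹ = x
    simp [padicPow_one]
  mul_smul a b x := by
    change (a.1 * b.1) * padicPow p x (cycloChar p K (a.2 * b.2) : ℤ_[p]) * (a.1 * b.1)⁻¹ =
      a.1 * padicPow p (b.1 * padicPow p x (cycloChar p K b.2 : ℤ_[p]) * b.1⁻¹)
        (cycloChar p K a.2 : ℤ_[p]) * a.1⁻¹
    rw [conj_padicPow, padicPow_padicPow, map_mul, Units.val_mul,
      mul_comm (cycloChar p K b.2 : ℤ_[p])]
    group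

/-- `C^∞(G, K)^{G × Γ}`: the algebra of locally constant functions `f : G → K` with `a • f = f` for
all `a ∈ G × Γ`, where `(a • f)(x) = f (a⁻¹ • x)`. -/
def invariantFunctions : Subalgebra K (LocallyConstant G K) :=
  letI := conjCycloAction p K G
  { carrier := {f | ∀ (a : G × CycloGal p K) (x : G), f (a⁻¹ • x) = f x}
    mul_mem' := fun {f g} hf hg a x => by
      change f _ * g _ = f _ * g _
      rw [hf, hg]
    add_mem' := fun {f g} hf hg a x => by
      change f _ + g _ = f _ + g _
      rw [hf, hg]
    algebraMap_mem' := fun _ _ _ => rfl }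

end Cyclotomic

/-! ### Artin representations and their Grothendieck ring -/

section Artin

variable (K : Type u) [Field K] (G : Type v) [Group G] [TopologicalSpace G]

/-- A finite dimensional representation is Artin if some open subgroup acts trivially. -/
def isArtin : ObjectProperty (FDRep K G) :=
  fun V => ∃ U : OpenSubgroup G, ∀ g ∈ U, V.ρ g = 1

instance : (isArtin K G).IsMonoidal where
  prop_unit := ⟨⊤, fun _ _ => rfl⟩
  prop_tensor := fun V W ⟨U, hU⟩ ⟨U', hU'⟩ => ⟨U ⊓ U', fun g hg => by
    have h1 := hU g hg.1
    have h2 := hU' g hg.2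
    change TensorProduct.map (V.ρ g) (W.ρ g) = 1
    rw [h1, h2]
    exact TensorProduct.map_one⟩

/-- The category of Artin `K`-representations of `G`. -/
abbrev ArtinRep := (isArtin K G).FullSubcategory

variable {K G}

/-- The linear map underlying a morphism of Artin representations. -/
def ArtinRep.toLin {V W : ArtinRep K G} (f : V ⟶ W) : V.obj →ₗ[K] W.obj :=
  f.hom.hom.hom.hom

/-- `0 → V' → V → V'' → 0` is an exact sequence of Artin representations. -/
structure ArtinRep.IsShortExact {V' V V'' : ArtinRep K G} (f : V' ⟶ V) (g : V ⟶ V'') : Prop where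
  injective : Function.Injective (ArtinRep.toLin f)
  exact : Function.Exact (ArtinRep.toLin f) (ArtinRep.toLin g)
  surjective : Function.Surjective (ArtinRep.toLin g)

theorem ArtinRep.IsShortExact.whiskerLeft (W : ArtinRep K G) {V' V V'' : ArtinRep K G}
    {f : V' ⟶ V} {g : V ⟶ V''} (h : ArtinRep.IsShortExact f g) :
    ArtinRep.IsShortExact (W ◁ f) (W ◁ g) where
  injective := by
    change Function.Injective (LinearMap.lTensor W.obj (ArtinRep.toLin f))
    exact Module.Flat.lTensor_preserves_injective_linearMap (M := W.obj) _ h.injective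
  exact := lTensor_exact W.obj h.exact h.surjective
  surjective := LinearMap.lTensor_surjective W.obj h.surjective

variable (K G)

/-- The class of `V` in the free abelian group on isomorphism classes of Artin representations. -/
def freeClass (V : ArtinRep K G) : FreeAbelianGroup (Skeleton (ArtinRep K G)) :=
  FreeAbelianGroup.of (toSkeleton V)

/-- The relations `[V] - [V'] - [V'']`, one for every exact sequence `0 → V' → V → V'' → 0`. -/
def exactRelations : Set (FreeAbelianGroup (Skeleton (ArtinRep K G))) :=
  {x | ∃ (V' V V'' : ArtinRep K G) (f : V' ⟶ V) (g : V ⟶ V''), ArtinRep.IsShortExact f g ∧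
    x = freeClass K G V - freeClass K G V' - freeClass K G V''}

/-- The subgroup generated by the relations `[V] - [V'] - [V'']`; it is an ideal for the
multiplication given by the tensor product. -/
def exactIdeal : Ideal (FreeAbelianGroup (Skeleton (ArtinRep K G))) :=
  { AddSubgroup.closure (exactRelations K G) with
    smul_mem' := fun c x hx => by
      change x ∈ AddSubgroup.closure (exactRelations K G) at hx
      change c * x ∈ AddSubgroup.closure (exactRelations K G)
      induction c using FreeAbelianGroup.induction_on with
      | zero => simp
      | of s =>
        obtain ⟨W, rfl⟩ : ∃ W : ArtinRep K G, toSkeleton W = s := ⟨s.out, Quotient.out_eq _⟩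
        induction hx using AddSubgroup.closure_induction with
        | mem x hx =>
          obtain ⟨V', V, V'', f, g, h, rfl⟩ := hx
          refine AddSubgroup.subset_closure ⟨W ⊗ V', W ⊗ V, W ⊗ V'', W ◁ f, W ◁ g,
            h.whiskerLeft W, ?_⟩
          simp only [freeClass, mul_sub, FreeAbelianGroup.of_mul_of,
            Skeleton.toSkeleton_tensorObj]
        | zero => simp
        | add x y _ _ hx hy => rw [mul_add]; exact add_mem hx hy
        | neg x _ hx => rw [mul_neg]; exact neg_mem hx
      | neg s h => rw [neg_mul]; exact neg_mem h
      | add a b ha hb => rw [add_mul]; exact add_mem ha hb }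

/-- The Grothendieck ring `K₀(𝒜)` of the category of Artin representations: generated by classes
`[V]` subject to `[V] = [V'] + [V'']` for exact sequences, with product `[V] [W] = [V ⊗ W]`. -/
abbrev ArtinK0 : Type (max (u + 1) v) :=
  FreeAbelianGroup (Skeleton (ArtinRep K G)) ⧸ exactIdeal K G

variable {K G}

/-- The class `[V] ∈ K₀(𝒜)` of an Artin representation. -/
def ArtinRep.cls (V : ArtinRep K G) : ArtinK0 K G :=
  Ideal.Quotient.mk (exactIdeal K G) (freeClass K G V)

end Artin

end

/-! Taking characters is a ring homomorphism on K₀(𝒜), because the trace is additive on exact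
sequences and multiplicative on tensor products. Three points remain.

Invariance: ρ(g) has p-power order pᵐ, so its eigenvalues are pᵐ-th roots of unity. An element σ of
Γ, extended to the algebraic closure, raises each of them to the power χ(σ), so it sends tr ρ(g) to
the trace of ρ(g ^ χ(σ)). But tr ρ(g) lies in K and is fixed (`trace_pow_eq_trace`).

Injectivity: the classes of irreducibles span K ⊗ K₀(𝒜), and their characters are linearly
independent by orthogonality on a finite quotient. K need not be a splitting field: it is enough
that dim End is nonzero in characteristic 0.

Surjectivity: an invariant f lives on a finite quotient Q, which is a p-group. A subalgebra of
functions on a finite set contains every function constant on the classes it does not separate, so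
it is enough that f(x) = f(y) whenever all characters of Q agree at x and y. The permutation
character of Q/⟨c⟩ is nonzero exactly on the elements conjugate into ⟨c⟩. Taking c = x and c = y
shows that y is conjugate to xᵏ with k prime to p. Since p is a uniformizer, the pᵐ-th cyclotomic
polynomial is irreducible over K by Eisenstein, so k ≡ χ(σ) mod pᵐ for some σ in Γ, and invariance
gives f(x) = f(y). No count of irreducible representations is needed. -/

noncomputable section

universe u v

/-! ### Galois action on traces of endomorphisms of finite order -/

section Trace

open Module

/-- If `σ` raises `n`-th roots of unity to the `k`-th power, then it maps the trace of an
endomorphism of order dividing `n` to the trace of its `k`-th power. -/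
theorem map_trace_eq_trace_pow_of_isAlgClosed {L W : Type*} [Field L] [IsAlgClosed L]
    [AddCommGroup W] [Module L W] [FiniteDimensional L W] (f : End L W) {n k : ℕ}
    (hn : (n : L) ≠ 0) (hf : f ^ n = 1) (σ : L →+* L) (hσ : ∀ ζ : L, ζ ^ n = 1 → σ ζ = ζ ^ k) :
    σ (LinearMap.trace L W f) = LinearMap.trace L W (f ^ k) := by
  classical
  -- `f` is killed by Xⁿ - 1, which is separable because n ≠ 0 in `L`; hence `f` is diagonalizable.
  have hss : f.IsSemisimple := by
    refine Module.End.isSemisimple_of_squarefree_aeval_eq_zero (p := Polynomial.X ^ n - 1)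
      (Polynomial.X_pow_sub_one_separable_iff.2 hn).squarefree ?_
    simp [hf]
  have hint : DirectSum.IsInternal f.eigenspace :=
    (DirectSum.isInternal_submodule_iff_iSupIndep_and_iSup_eq_top _).2
      ⟨f.eigenspaces_iSupIndep, hss.iSup_eigenspace_eq_top⟩
  have hfin : {μ | f.eigenspace μ ≠ ⊥}.Finite :=
    WellFoundedGT.finite_ne_bot_of_iSupIndep f.eigenspaces_iSupIndep
  have hpow : ∀ (j : ℕ) (μ : L) (w : W), w ∈ f.eigenspace μ → (f ^ j) w = μ ^ j • w := by
    intro j μ w hw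
    induction j with
    | zero => simp
    | succ j ih =>
      rw [pow_succ', Module.End.mul_apply, ih, map_smul, Module.End.mem_eigenspace_iff.1 hw,
        smul_smul, pow_succ]
  have hmaps : ∀ (j : ℕ) (μ : L),
      Set.MapsTo (f ^ j) (f.eigenspace μ : Set W) (f.eigenspace μ : Set W) := by
    intro j μ w hw
    rw [hpow j μ w hw]
    exact Submodule.smul_mem _ _ hw
  -- The eigenspaces of `f` serve for every power, so the multiplicities do not depend on `j`; being
  -- integers, they are fixed by `σ`.
  have htr : ∀ j : ℕ, LinearMap.trace L W (f ^ j) =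
      ∑ μ ∈ hfin.toFinset, μ ^ j * (finrank L (f.eigenspace μ) : L) := by
    intro j
    rw [LinearMap.trace_eq_sum_trace_restrict' hint hfin (hmaps j)]
    refine Finset.sum_congr rfl fun μ _ => ?_
    have : (f ^ j).restrict (hmaps j μ) = μ ^ j • (1 : End L (f.eigenspace μ)) := by
      ext w
      exact hpow j μ w w.2
    rw [this, map_smul, LinearMap.trace_one, smul_eq_mul]
  have h1 := htr 1
  rw [pow_one] at h1
  rw [h1, htr k, map_sum]
  refine Finset.sum_congr rfl fun μ hμ => ?_
  rw [map_mul, map_natCast, pow_one]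
  obtain ⟨w, hw, hw0⟩ := Submodule.exists_mem_ne_zero_of_ne_bot (hfin.mem_toFinset.1 hμ)
  have hμn : μ ^ n = 1 := by
    have := hpow n μ w hw
    rw [hf, Module.End.one_apply] at this
    have h2 : (1 - μ ^ n) • w = 0 := by rw [sub_smul, one_smul, ← this, sub_self]
    exact (sub_eq_zero.1 ((smul_eq_zero.1 h2).resolve_right hw0)).symm
  rw [hσ μ hμn]

/-- If some automorphism of an algebraic closure of `K` over `K` raises `n`-th roots of unity to
the `k`-th power, then `f` and `f ^ k` have the same trace for `f ^ n = 1`. -/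
theorem trace_pow_eq_trace {K V : Type*} [Field K] [AddCommGroup V] [Module K V]
    [FiniteDimensional K V] (f : End K V) {n k : ℕ} (hn : (n : K) ≠ 0) (hf : f ^ n = 1)
    (σ : AlgebraicClosure K ≃ₐ[K] AlgebraicClosure K)
    (hσ : ∀ ζ : AlgebraicClosure K, ζ ^ n = 1 → σ ζ = ζ ^ k) :
    LinearMap.trace K V (f ^ k) = LinearMap.trace K V f := by
  refine (algebraMap K (AlgebraicClosure K)).injective ?_
  have hn' : (n : AlgebraicClosure K) ≠ 0 := by
    rw [← map_natCast (algebraMap K (AlgebraicClosure K))]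
    exact (map_ne_zero _).2 hn
  have hf' : (f.baseChange (AlgebraicClosure K)) ^ n = 1 := by
    rw [← LinearMap.baseChange_pow, hf, LinearMap.baseChange_one]
  have := map_trace_eq_trace_pow_of_isAlgClosed _ hn' hf' (σ : _ →+* _) hσ
  rw [← LinearMap.baseChange_pow, LinearMap.trace_baseChange, LinearMap.trace_baseChange] at this
  rw [← this]
  exact σ.commutes _

end Trace

/-! ### Irreducibility of cyclotomic polynomials by Eisenstein's criterion -/

section CyclotomicIrreducible

open Polynomial

/-- The `p ^ n`-th cyclotomic polynomial is irreducible over a discretely valued field of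
characteristic zero with uniformizer `p`. -/
theorem cyclotomic_prime_pow_irreducible {p : ℕ} [hpr : Fact p.Prime]
    {R : Type*} [CommRing R] [IsDomain R] [IsDiscreteValuationRing R] (hp : Irreducible (p : R))
    (K : Type*) [Field K] [Algebra R K] [IsFractionRing R K] (n : ℕ) :
    Irreducible (cyclotomic (p ^ n) K) := by
  cases n with
  | zero => simpa using irreducible_X_sub_C (1 : K)
  | succ n =>
  have hmon : ((cyclotomic (p ^ (n + 1)) ℤ).comp (X + 1)).Monic := by
    rw [show (X + 1 : ℤ[X]) = X + C 1 by simp]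
    refine (cyclotomic.monic _ ℤ).comp (monic_X_add_C 1) fun h => ?_
    rw [natDegree_X_add_C] at h
    exact zero_ne_one h.symm
  have hprime : (Ideal.span {(p : R)}).IsPrime :=
    (Ideal.span_singleton_prime hp.ne_zero).2 hp.prime
  have hE := cyclotomic_prime_pow_comp_X_add_one_isEisensteinAt p n
  set q : R[X] := ((cyclotomic (p ^ (n + 1)) ℤ).comp (X + 1)).map (Int.castRingHom R) with hq
  have hqmon : q.Monic := hmon.map _
  have hdeg : q.natDegree = ((cyclotomic (p ^ (n + 1)) ℤ).comp (X + 1)).natDegree :=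
    hmon.natDegree_map _
  have hcomp : q = (cyclotomic (p ^ (n + 1)) R).comp (X + 1) := by
    rw [hq, Polynomial.map_comp]
    simp
  -- Divisibility of the lower coefficients by p comes from ℤ. The constant term is the value of the
  -- cyclotomic polynomial at 1, namely p, and p ∉ p²R because p is not a unit.
  have hqE : q.IsEisensteinAt (Ideal.span {(p : R)}) := by
    refine hqmon.isEisensteinAt_of_mem_of_notMem hprime.ne_top (fun {i} hi => ?_) ?_
    · have := hE.mem (hdeg ▸ hi)
      rw [Ideal.submodule_span_eq, Ideal.mem_span_singleton] at this
      rw [hq, coeff_map, Ideal.mem_span_singleton]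
      simpa using (map_dvd (Int.castRingHom R) this)
    · rw [hcomp, coeff_zero_eq_eval_zero, eval_comp, Ideal.span_singleton_pow,
        Ideal.mem_span_singleton]
      simp only [eval_add, eval_X, eval_one, zero_add]
      rw [eval_one_cyclotomic_prime_pow]
      intro h
      rw [pow_two] at h
      exact hp.not_isUnit (isUnit_of_dvd_one
        ((mul_dvd_mul_iff_left hp.ne_zero).1 (by rwa [mul_one])))
  have hirr : Irreducible q := by
    refine hqE.irreducible hprime hqmon.isPrimitive ?_
    rw [hcomp, natDegree_comp, natDegree_cyclotomic, show (X + 1 : R[X]) = X + C 1 by simp,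
      natDegree_X_add_C, mul_one]
    exact Nat.totient_pos.2 (pow_pos hpr.out.pos _)
  -- X ↦ X + 1 is an automorphism of R[X], so the shift can be undone; Gauss's lemma then passes
  -- from R to K.
  have hcycR : Irreducible (cyclotomic (p ^ (n + 1)) R) := by
    have h1 := (MulEquiv.irreducible_iff (algEquivAevalXAddC (1 : R))
      (x := cyclotomic (p ^ (n + 1)) R))
    rw [← h1]
    have : algEquivAevalXAddC (1 : R) (cyclotomic (p ^ (n + 1)) R) = q := by
      rw [hcomp]
      simp [comp, aeval_def]
    rwa [this]
  have := ((cyclotomic.monic (p ^ (n + 1)) R).irreducible_iff_irreducible_map_fraction_map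
    (K := K)).1 hcycR
  rwa [map_cyclotomic] at this

end CyclotomicIrreducible

/-! ### Values of the cyclotomic character -/

section GaloisCyclotomic

variable (p : ℕ) (K : Type u) [Field K]

instance normal_cycloInfty : Normal K (CycloInfty p K) := by
  rw [IntermediateField.normal_iff_forall_map_le]
  intro σ
  rw [IntermediateField.adjoin_map, IntermediateField.adjoin_le_iff]
  rintro _ ⟨ζ, ⟨n, hn⟩, rfl⟩
  refine IntermediateField.subset_adjoin _ _ ⟨n, ?_⟩
  rw [← map_pow, hn, map_one]

/-- Every element of `Γ` extends to an automorphism of the algebraic closure. -/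
theorem exists_algEquiv_extending (σ : CycloGal p K) :
    ∃ τ : AlgebraicClosure K ≃ₐ[K] AlgebraicClosure K,
      ∀ x : CycloInfty p K, τ x = (σ x : AlgebraicClosure K) :=
  ⟨σ.liftNormal (AlgebraicClosure K), fun x => σ.liftNormal_commutes (AlgebraicClosure K) x⟩

variable {p K} [Fact p.Prime] [CharZero K]

/-- An irreducible cyclotomic polynomial is the minimal polynomial of both ζ and ζᵏ, so the two are
conjugate, and normality provides a σ with σ ζ = ζᵏ. -/
theorem exists_cycloChar_toZModPow_eq {n : ℕ}
    (hirr : Irreducible (Polynomial.cyclotomic (p ^ n) K)) {k : ℕ} (hk : k.Coprime p) :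
    ∃ σ : CycloGal p K, (p : ℤ_[p]) ^ n ∣ (cycloChar p K σ : ℤ_[p]) - k := by
  have hp : p.Prime := Fact.out
  have : NeZero (p ^ n) := ⟨pow_ne_zero _ hp.ne_zero⟩
  obtain ⟨ζ, hζ⟩ := HasEnoughRootsOfUnity.exists_primitiveRoot (CycloInfty p K) (p ^ n)
  have hζk : IsPrimitiveRoot (ζ ^ k) (p ^ n) := hζ.pow_of_coprime k (hk.pow_right n)
  have hmin : ∀ ξ : CycloInfty p K, IsPrimitiveRoot ξ (p ^ n) →
      Polynomial.cyclotomic (p ^ n) K = minpoly K ξ := fun ξ hξ => by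
    refine minpoly.eq_of_irreducible_of_monic hirr ?_ (Polynomial.cyclotomic.monic _ _)
    have := (Polynomial.isRoot_cyclotomic_iff_charZero (NeZero.pos _)).2 hξ
    rwa [← Polynomial.map_cyclotomic (p ^ n) (algebraMap K (CycloInfty p K)),
      Polynomial.IsRoot, Polynomial.eval_map_algebraMap] at this
  have hconj : IsConjRoot K (ζ ^ k) ζ := by
    rw [isConjRoot_def, ← hmin _ hζk, ← hmin _ hζ]
  obtain ⟨σ, hσ⟩ := hconj.exists_algEquiv
  refine ⟨σ, ?_⟩
  rw [cycloChar_spec p K σ n ζ hζ.pow_eq_one] at hσ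
  rw [← Ideal.mem_span_singleton, ← PadicInt.ker_toZModPow, RingHom.mem_ker, map_sub,
    map_natCast, sub_eq_zero]
  -- Powers of ζ determine exponents only below pⁿ, so `k` is reduced first.
  have hk' : ζ ^ (k % p ^ n) = ζ ^ k := by
    conv_rhs => rw [← pow_mod_orderOf, ← hζ.eq_orderOf]
  have := hζ.pow_inj (ZMod.val_lt _) (Nat.mod_lt _ (NeZero.pos _)) (hσ.trans hk'.symm)
  rw [← ZMod.natCast_zmod_val (PadicInt.toZModPow n _), this, ZMod.natCast_mod]

end GaloisCyclotomic

/-! ### Additivity of the trace -/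

section TraceExact

/-- The trace is additive on short exact sequences. -/
theorem trace_eq_add_of_exact {K V' V V'' : Type*} [Field K] [AddCommGroup V'] [Module K V']
    [AddCommGroup V] [Module K V] [AddCommGroup V''] [Module K V'']
    [FiniteDimensional K V'] [FiniteDimensional K V] [FiniteDimensional K V'']
    {i : V' →ₗ[K] V} {q : V →ₗ[K] V''} (hi : Function.Injective i) (hiq : Function.Exact i q)
    (hq : Function.Surjective q) {T' : V' →ₗ[K] V'} {T : V →ₗ[K] V} {T'' : V'' →ₗ[K] V''}
    (h' : T ∘ₗ i = i ∘ₗ T') (h'' : q ∘ₗ T = T'' ∘ₗ q) :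
    LinearMap.trace K V T = LinearMap.trace K V' T' + LinearMap.trace K V'' T'' := by
  obtain ⟨r, hr⟩ := i.exists_leftInverse_of_injective (LinearMap.ker_eq_bot.2 hi)
  obtain ⟨t, ht⟩ := q.exists_rightInverse_of_surjective (LinearMap.range_eq_top.2 hq)
  have hri : ∀ v, r (i v) = v := fun v => LinearMap.congr_fun hr v
  have htq : ∀ v, q (t v) = v := fun v => LinearMap.congr_fun ht v
  have hqi : ∀ v, q (i v) = 0 := hiq.apply_apply_eq_zero
  -- The section `t` is corrected so that r ∘ s = 0; then id = i ∘ r + s ∘ q. Cyclicity of the trace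
  -- reduces the two pieces of `T` to `T'` and `T''`.
  set s : V'' →ₗ[K] V := t - i ∘ₗ r ∘ₗ t with hs
  have hsum : T = (T ∘ₗ i) ∘ₗ r + T ∘ₗ s ∘ₗ q := by
    ext v
    obtain ⟨w, hw⟩ := (hiq (v - t (q v))).1 (by rw [map_sub, htq, sub_self])
    have hv : v = i w + t (q v) := by rw [hw, sub_add_cancel]
    have : i (r v) + s (q v) = v := by
      simp only [hs, LinearMap.sub_apply, LinearMap.comp_apply]
      have h1 : r v = w + r (t (q v)) := by
        conv_lhs => rw [hv, map_add, hri]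
      rw [h1, map_add]
      conv_rhs => rw [hv]
      abel
    simp only [LinearMap.add_apply, LinearMap.comp_apply]
    rw [← map_add, this]
  have hqs : q ∘ₗ s = LinearMap.id := by
    ext v
    simp [hs, htq, hqi]
  conv_lhs => rw [hsum]
  rw [map_add, h', LinearMap.comp_assoc, LinearMap.trace_comp_comm' (T' ∘ₗ r) i, LinearMap.comp_assoc, hr,
    LinearMap.comp_id, ← LinearMap.comp_assoc, LinearMap.trace_comp_comm' q (T ∘ₗ s),
    ← LinearMap.comp_assoc, h'', LinearMap.comp_assoc, hqs, LinearMap.comp_id]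

end TraceExact

/-! ### Finite quotients of profinite groups -/

section ProfiniteGroup

variable {G : Type v} [Group G] [TopologicalSpace G] [IsTopologicalGroup G] [CompactSpace G]
  [TotallyDisconnectedSpace G]

theorem exists_openNormalSubgroup_le (U : OpenSubgroup G) :
    ∃ N : OpenNormalSubgroup G, ∀ g ∈ N.toSubgroup, g ∈ U := by
  obtain ⟨N, hN⟩ := ProfiniteGrp.exist_openNormalSubgroup_sub_open_nhds_of_one
    U.isOpen U.one_mem
  exact ⟨N, fun g hg => hN hg⟩

/-- A locally constant function on a profinite group factors through a finite quotient. -/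
theorem exists_openNormalSubgroup_factor {X : Type*} (f : LocallyConstant G X) :
    ∃ N : OpenNormalSubgroup G, ∀ g h : G, (g : G ⧸ N.toSubgroup) = h → f g = f h := by
  -- This open set contains {1} × G, so by compactness of `G` the tube lemma gives a neighbourhood
  -- of 1 that works for all x at once.
  have hopen : IsOpen {x : G × G | f (x.2 * x.1) = f x.2} := by
    let _ : TopologicalSpace X := ⊥
    have : DiscreteTopology X := ⟨rfl⟩
    have hc : Continuous f := f.continuous
    have h2 : Continuous fun x : G × G => (f (x.2 * x.1), f x.2) := by fun_prop
    exact (isOpen_discrete {y : X × X | y.1 = y.2}).preimage h2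
  obtain ⟨u, w, hu, -, h1u, hw, huw⟩ := generalized_tube_lemma (isCompact_singleton (x := (1 : G)))
    (isCompact_univ (X := G)) hopen (by rintro ⟨a, b⟩ ⟨rfl, -⟩; simp)
  obtain ⟨N, hN⟩ := ProfiniteGrp.exist_openNormalSubgroup_sub_open_nhds_of_one hu (h1u rfl)
  refine ⟨N, fun g h hgh => ?_⟩
  have := huw (Set.mk_mem_prod (hN (QuotientGroup.eq.1 hgh)) (hw (Set.mem_univ g)))
  simpa using this.symm

instance finite_quotient_openNormalSubgroup (N : OpenNormalSubgroup G) :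
    Finite (G ⧸ N.toSubgroup) :=
  Subgroup.quotient_finite_of_isOpen N.toSubgroup N.toOpenSubgroup.isOpen

end ProfiniteGroup

/-! ### The character homomorphism on K ⊗ K₀(𝒜) -/

section CharacterMap

variable {K : Type u} [Field K] {G : Type v} [Group G] [TopologicalSpace G]

theorem closure_range_cls :
    AddSubgroup.closure (Set.range (ArtinRep.cls (K := K) (G := G))) = ⊤ := by
  rw [eq_top_iff]
  rintro x -
  obtain ⟨y, rfl⟩ := Ideal.Quotient.mk_surjective x
  induction y using FreeAbelianGroup.induction_on with
  | zero => simp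
  | of s =>
    refine AddSubgroup.subset_closure ⟨(fromSkeleton (ArtinRep K G)).obj s, ?_⟩
    rw [ArtinRep.cls, freeClass, toSkeleton_fromSkeleton_obj]
  | neg s h => rw [map_neg]; exact neg_mem h
  | add a b ha hb => rw [map_add]; exact add_mem ha hb

/-- A set generating `K₀(𝒜)` as a group spans `K ⊗ K₀(𝒜)`. -/
theorem span_tmul_of_closure_eq_top {s : Set (ArtinK0 K G)} (hs : AddSubgroup.closure s = ⊤) :
    Submodule.span K ((fun x => (1 : K) ⊗ₜ[ℤ] x) '' s) =
      (⊤ : Submodule K (K ⊗[ℤ] ArtinK0 K G)) := by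
  rw [eq_top_iff]
  rintro x -
  induction x with
  | zero => simp
  | tmul c y =>
    have hy : y ∈ AddSubgroup.closure s := hs ▸ AddSubgroup.mem_top y
    rw [show c ⊗ₜ[ℤ] y = c • ((1 : K) ⊗ₜ[ℤ] y) by
      rw [TensorProduct.smul_tmul', smul_eq_mul, mul_one]]
    refine Submodule.smul_mem _ _ ?_
    induction hy using AddSubgroup.closure_induction with
    | mem y hy => exact Submodule.subset_span ⟨y, hy, rfl⟩
    | zero => simp
    | add a b _ _ ha hb => rw [TensorProduct.tmul_add]; exact add_mem ha hb
    | neg a _ ha => rw [TensorProduct.tmul_neg]; exact neg_mem ha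
  | add a b ha hb => exact add_mem ha hb

namespace ArtinRep

theorem toLin_ρ {V W : ArtinRep K G} (f : V ⟶ W) (g : G) :
    toLin f ∘ₗ V.obj.ρ g = W.obj.ρ g ∘ₗ toLin f := by
  ext v
  exact ConcreteCategory.congr_hom ((forget (FGModuleCat K)).congr_map (f.hom.comm g)) v

theorem IsShortExact.character_eq_add {V' V V'' : ArtinRep K G} {f : V' ⟶ V} {q : V ⟶ V''}
    (h : IsShortExact f q) (g : G) :
    V.obj.character g = V'.obj.character g + V''.obj.character g :=
  trace_eq_add_of_exact h.injective h.exact h.surjective (toLin_ρ f g).symm (toLin_ρ q g)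

theorem character_congr {V W : ArtinRep K G} (e : V ≅ W) :
    V.obj.character = W.obj.character :=
  FDRep.char_iso ((isArtin K G).ι.mapIso e)

variable [IsTopologicalGroup G]

/-- The character of an Artin representation, as a locally constant function. -/
def locChar (V : ArtinRep K G) : LocallyConstant G K where
  toFun := V.obj.character
  isLocallyConstant := by
    obtain ⟨U, hU⟩ := V.property
    refine (IsLocallyConstant.iff_exists_open _).2 fun g =>
      ⟨(fun x => g⁻¹ * x) ⁻¹' U, U.isOpen.preimage (continuous_const_mul _), by simp, ?_⟩
    intro x hx
    have : V.obj.ρ x = V.obj.ρ g * V.obj.ρ (g⁻¹ * x) := by rw [← map_mul, mul_inv_cancel_left]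
    rw [FDRep.character, this, hU _ hx, mul_one, FDRep.character]

theorem locChar_congr {V W : ArtinRep K G} (e : V ≅ W) : V.locChar = W.locChar :=
  LocallyConstant.ext fun g => congrFun (character_congr e) g

theorem locChar_out (V : ArtinRep K G) :
    locChar ((fromSkeleton (ArtinRep K G)).obj (toSkeleton V)) = V.locChar :=
  locChar_congr (fromSkeletonToSkeletonIso V)

end ArtinRep

variable [IsTopologicalGroup G]

variable (K G) in
/-- The character as a function on isomorphism classes. -/
def skeletonChar : Skeleton (ArtinRep K G) →* LocallyConstant G K where
  toFun s := ArtinRep.locChar ((fromSkeleton (ArtinRep K G)).obj s)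
  map_one' := by
    rw [Skeleton.one_eq, ArtinRep.locChar_out]
    ext g
    change LinearMap.trace K K (LinearMap.id : K →ₗ[K] K) = 1
    simp
  map_mul' s t := by
    rw [Skeleton.mul_eq, ArtinRep.locChar_out]
    ext g
    exact congrFun (FDRep.char_tensor (s.out).obj (t.out).obj) g

theorem skeletonChar_toSkeleton (V : ArtinRep K G) :
    skeletonChar K G (toSkeleton V) = V.locChar := V.locChar_out

theorem liftMonoid_skeletonChar_freeClass (V : ArtinRep K G) :
    FreeAbelianGroup.liftMonoid (skeletonChar K G) (freeClass K G V) = V.locChar := by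
  rw [FreeAbelianGroup.liftMonoid_coe, freeClass, FreeAbelianGroup.lift_apply_of]
  exact skeletonChar_toSkeleton V

variable (K G) in
/-- The character as a ring homomorphism on the Grothendieck ring. -/
def K0Char : ArtinK0 K G →+* LocallyConstant G K :=
  Ideal.Quotient.lift (exactIdeal K G) (FreeAbelianGroup.liftMonoid (skeletonChar K G)) (by
    intro x hx
    change x ∈ AddSubgroup.closure (exactRelations K G) at hx
    induction hx using AddSubgroup.closure_induction with
    | mem x hx =>
      obtain ⟨V', V, V'', f, q, h, rfl⟩ := hx
      have hadd : V.locChar = V'.locChar + V''.locChar :=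
        LocallyConstant.ext fun g => h.character_eq_add g
      simp only [map_sub, liftMonoid_skeletonChar_freeClass]
      rw [hadd, sub_sub, sub_self]
    | zero => simp
    | add x y _ _ hx hy => rw [map_add, hx, hy, add_zero]
    | neg x _ hx => rw [map_neg, hx, neg_zero])

theorem K0Char_cls (V : ArtinRep K G) : K0Char K G V.cls = V.locChar :=
  (Ideal.Quotient.lift_mk _ _ _).trans (liftMonoid_skeletonChar_freeClass V)

variable (K G) in
/-- The character as a homomorphism of `K`-algebras on `K ⊗ K₀(𝒜)`. -/
def tensorChar : K ⊗[ℤ] ArtinK0 K G →ₐ[K] LocallyConstant G K :=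
  Algebra.TensorProduct.lift (Algebra.ofId K (LocallyConstant G K)) (K0Char K G).toIntAlgHom
    fun _ _ => Commute.all _ _

theorem tensorChar_tmul_cls (c : K) (V : ArtinRep K G) :
    tensorChar K G (c ⊗ₜ V.cls) = c • V.locChar := by
  change algebraMap K (LocallyConstant G K) c * K0Char K G V.cls = _
  rw [K0Char_cls, Algebra.smul_def]

end CharacterMap

/-! ### Invariance of characters under G × Γ -/

section Invariance

variable {p : ℕ} [Fact p.Prime] {K : Type u} [Field K] [CharZero K] {G : Type v} [Group G]
  [TopologicalSpace G] [IsTopologicalGroup G] [CompactSpace G] [TotallyDisconnectedSpace G]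
  [IsProP p G]

/-- Modulo an open normal subgroup acting trivially, the p-adic power is gᵏ for a natural number k ≡
χ(σ) mod pᵐ, and the eigenvalue argument of `trace_pow_eq_trace` applies. -/
theorem ArtinRep.character_padicPow (V : ArtinRep K G) (σ : CycloGal p K) (g : G) :
    V.obj.character (padicPow p g (cycloChar p K σ : ℤ_[p])) = V.obj.character g := by
  obtain ⟨U, hU⟩ := V.property
  obtain ⟨N, hN⟩ := exists_openNormalSubgroup_le U
  have hfac : ∀ x y : G, (x : G ⧸ N.toSubgroup) = y → V.obj.ρ x = V.obj.ρ y := by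
    intro x y hxy
    have : V.obj.ρ y = V.obj.ρ x * V.obj.ρ (x⁻¹ * y) := by rw [← map_mul, mul_inv_cancel_left]
    rw [this, hU _ (hN _ (QuotientGroup.eq.1 hxy)), mul_one]
  obtain ⟨m, hm⟩ := exists_pow_mem (p := p) N g
  set k := ((cycloChar p K σ : ℤ_[p]).toZModPow m).val with hk
  have hp0 : p ≠ 0 := (Fact.out : p.Prime).ne_zero
  have : NeZero (p ^ m) := ⟨pow_ne_zero _ hp0⟩
  have hdvd : (p : ℤ_[p]) ^ m ∣ (cycloChar p K σ : ℤ_[p]) - k := by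
    rw [← Ideal.mem_span_singleton, ← PadicInt.ker_toZModPow, RingHom.mem_ker, map_sub,
      map_natCast, sub_eq_zero, hk, ZMod.natCast_zmod_val]
  have h1 := mk_padicPow hm hdvd
  rw [← QuotientGroup.mk_pow] at h1
  have hf : V.obj.ρ g ^ p ^ m = 1 := by
    rw [← map_pow, ← map_one V.obj.ρ]
    exact hfac _ _ (by rw [QuotientGroup.mk_pow, hm, QuotientGroup.mk_one])
  rw [FDRep.character, hfac _ _ h1, map_pow]
  obtain ⟨τ, hτ⟩ := exists_algEquiv_extending p K σ
  refine trace_pow_eq_trace _ (by exact_mod_cast pow_ne_zero m hp0) hf τ fun ζ hζ => ?_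
  have hmem : ζ ∈ CycloInfty p K := IntermediateField.subset_adjoin _ _ ⟨m, hζ⟩
  have h2 := cycloChar_spec p K σ m ⟨ζ, hmem⟩ (Subtype.ext hζ)
  have h3 := hτ ⟨ζ, hmem⟩
  rw [h2] at h3
  exact h3

variable (p) in
theorem ArtinRep.locChar_mem_invariantFunctions (V : ArtinRep K G) :
    V.locChar ∈ invariantFunctions p K G := by
  intro a x
  change V.obj.character (a⁻¹.1 * padicPow p x (cycloChar p K a⁻¹.2 : ℤ_[p]) * a⁻¹.1⁻¹) = _
  rw [FDRep.char_conj, character_padicPow]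
  rfl

variable (p K G) in
theorem tensorChar_mem_invariantFunctions (x : K ⊗[ℤ] ArtinK0 K G) :
    tensorChar K G x ∈ invariantFunctions p K G := by
  have hx : x ∈ Submodule.span K
      ((fun y => (1 : K) ⊗ₜ[ℤ] y) '' Set.range (ArtinRep.cls (K := K) (G := G))) := by
    rw [span_tmul_of_closure_eq_top closure_range_cls]
    exact Submodule.mem_top
  induction hx using Submodule.span_induction with
  | mem x hx =>
    obtain ⟨_, ⟨V, rfl⟩, rfl⟩ := hx
    change tensorChar K G ((1 : K) ⊗ₜ[ℤ] V.cls) ∈ invariantFunctions p K G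
    rw [tensorChar_tmul_cls, one_smul]
    exact V.locChar_mem_invariantFunctions p
  | zero => rw [map_zero]; exact zero_mem _
  | add x y _ _ hx hy => rw [map_add]; exact add_mem hx hy
  | smul c x _ hx => rw [map_smul]; exact Subalgebra.smul_mem _ hx c

end Invariance

/-! ### Generation of K₀(𝒜) by irreducible representations -/

section Irreducible

open Representation Module

variable {K : Type u} [Field K] {G : Type v} [Group G] [TopologicalSpace G]

namespace ArtinRep

/-- The representation underlying an Artin representation. -/
abbrev rep (V : ArtinRep K G) : Representation K G V.obj := V.obj.ρ

/-- An Artin representation from an unbundled representation. -/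
def ofRep {V : Type u} [AddCommGroup V] [Module K V] [FiniteDimensional K V]
    (ρ : Representation K G V) (h : ∃ U : OpenSubgroup G, ∀ g ∈ U, ρ g = 1) : ArtinRep K G :=
  ⟨FDRep.of ρ, h⟩

/-- A morphism of Artin representations from an equivariant linear map. -/
def homOfLin {V W : ArtinRep K G} (f : V.obj →ₗ[K] W.obj)
    (hf : ∀ g, f ∘ₗ V.obj.ρ g = W.obj.ρ g ∘ₗ f) : V ⟶ W :=
  ObjectProperty.homMk ⟨InducedCategory.homMk (ModuleCat.ofHom f), fun g => by
    ext1
    exact hf g⟩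

theorem toLin_injective {V W : ArtinRep K G} :
    Function.Injective (toLin : (V ⟶ W) → (V.obj →ₗ[K] W.obj)) := by
  intro f g h
  ext1
  ext1
  ext1
  exact h

/-- An isomorphism of Artin representations from an equivalence of representations. -/
def isoOfEquiv {V W : ArtinRep K G} (e : V.rep.Equiv W.rep) : V ≅ W where
  hom := homOfLin e.toLinearMap e.isIntertwining'
  inv := homOfLin e.symm.toLinearMap e.symm.isIntertwining'
  hom_inv_id := toLin_injective (LinearMap.ext fun v => e.symm_apply_apply v)
  inv_hom_id := toLin_injective (LinearMap.ext fun v => e.apply_symm_apply v)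

theorem IsShortExact.cls_eq_add {V' V V'' : ArtinRep K G} {f : V' ⟶ V} {q : V ⟶ V''}
    (h : IsShortExact f q) : V.cls = V'.cls + V''.cls := by
  rw [← sub_eq_zero, ← sub_sub, cls, cls, cls, ← map_sub, ← map_sub, Ideal.Quotient.eq_zero_iff_mem]
  exact AddSubgroup.subset_closure ⟨V', V, V'', f, q, h, rfl⟩

theorem cls_eq_zero (V : ArtinRep K G) [Subsingleton V.obj] : V.cls = 0 := by
  -- For zero `V` this sequence is exact and gives [V] = [V] + [V].
  have h : IsShortExact (𝟙 V) (𝟙 V) :=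
    ⟨Function.injective_of_subsingleton _, fun x => ⟨fun _ => ⟨0, Subsingleton.elim _ _⟩,
      fun _ => Subsingleton.elim _ _⟩, fun x => ⟨0, Subsingleton.elim _ _⟩⟩
  simpa using h.cls_eq_add

/-- The subrepresentation of an Artin representation. -/
def sub (V : ArtinRep K G) (W : Subrepresentation V.rep) : ArtinRep K G :=
  ofRep W.toRepresentation (by
    obtain ⟨U, hU⟩ := V.property
    refine ⟨U, fun g hg => LinearMap.ext fun w => Subtype.ext ?_⟩
    exact LinearMap.congr_fun (hU g hg) w.1)

/-- The quotient of an Artin representation by a subrepresentation. -/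
def quot (V : ArtinRep K G) (W : Subrepresentation V.rep) : ArtinRep K G :=
  ofRep (V.rep.quotient W.toSubmodule fun g _ hw => W.apply_mem_toSubmodule g hw) (by
    obtain ⟨U, hU⟩ := V.property
    refine ⟨U, fun g hg => Submodule.linearMap_qext _ (LinearMap.ext fun w => ?_)⟩
    exact congrArg (Submodule.Quotient.mk (p := W.toSubmodule)) (LinearMap.congr_fun (hU g hg) w))

theorem cls_eq_sub_add_quot (V : ArtinRep K G) (W : Subrepresentation V.rep) :
    V.cls = (V.sub W).cls + (V.quot W).cls := by
  refine IsShortExact.cls_eq_add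
    (f := homOfLin (V := V.sub W) (W := V) W.toSubmodule.subtype fun g => rfl)
    (q := homOfLin (V := V) (W := V.quot W) W.toSubmodule.mkQ fun g => rfl) ⟨?_, ?_, ?_⟩
  · exact Subtype.val_injective
  · exact LinearMap.exact_subtype_mkQ W.toSubmodule
  · exact Submodule.mkQ_surjective W.toSubmodule

/-- Induction on dimension: a proper nonzero W gives [V] = [W] + [V/W], with both terms of smaller
dimension. Semisimplicity plays no role. -/
theorem cls_mem_closure_irreducible (V : ArtinRep K G) :
    V.cls ∈ AddSubgroup.closure (cls '' {S : ArtinRep K G | S.rep.IsIrreducible}) := by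
  induction hn : finrank K V.obj using Nat.strong_induction_on generalizing V with
  | _ n ih =>
  subst hn
  by_cases hs : Subsingleton V.obj
  · rw [V.cls_eq_zero]
    exact zero_mem _
  by_cases hirr : V.rep.IsIrreducible
  · exact AddSubgroup.subset_closure ⟨V, hirr, rfl⟩
  have hnt : Nontrivial V.obj := not_subsingleton_iff_nontrivial.1 hs
  have hnt' : Nontrivial (Subrepresentation V.rep) :=
    ⟨⊥, ⊤, fun h => bot_ne_top (α := Submodule K V.obj)
      (congrArg Subrepresentation.toSubmodule h)⟩
  obtain ⟨W, hW0, hW1⟩ : ∃ W : Subrepresentation V.rep, W ≠ ⊥ ∧ W ≠ ⊤ := by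
    by_contra! h
    exact hirr ⟨fun W => or_iff_not_imp_left.2 (h W)⟩
  have hW0' : W.toSubmodule ≠ ⊥ := fun h => hW0 (Subrepresentation.toSubmodule_injective h)
  have hW1' : W.toSubmodule ≠ ⊤ := fun h => hW1 (Subrepresentation.toSubmodule_injective h)
  rw [V.cls_eq_sub_add_quot W]
  refine add_mem (ih _ ?_ (V.sub W) rfl) (ih _ ?_ (V.quot W) rfl)
  · exact Submodule.finrank_lt hW1'
  · have h1 := Submodule.finrank_quotient_add_finrank W.toSubmodule
    have h2 : 0 < finrank K W.toSubmodule := Submodule.one_le_finrank_iff.2 hW0'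
    change finrank K (V.obj ⧸ W.toSubmodule) < _
    omega

end ArtinRep

theorem closure_cls_irreducible :
    AddSubgroup.closure (ArtinRep.cls '' {S : ArtinRep K G | S.rep.IsIrreducible}) = ⊤ := by
  rw [eq_top_iff, ← closure_range_cls, AddSubgroup.closure_le]
  rintro _ ⟨V, rfl⟩
  exact V.cls_mem_closure_irreducible

end Irreducible

/-! ### Orthogonality of characters over a field that need not split -/

section Orthogonality

open Representation Module

variable {K : Type*} [Field K] [CharZero K] {G : Type*} [Group G] (N : Subgroup G) [N.Normal]
  {V W : Type*} [AddCommGroup V] [Module K V] [FiniteDimensional K V] [AddCommGroup W]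
  [Module K W] [FiniteDimensional K W] (ρ : Representation K G V) (σ : Representation K G W)

/-- The scalar product of functions on a group modulo a normal subgroup. -/
def quotientPairing (a b : G → K) : K := ∑ᶠ q : G ⧸ N, a q.out * b q.out⁻¹

omit [CharZero K] [N.Normal] in
theorem quotientPairing_sum_smul [Finite (G ⧸ N)] {ι : Type*} (s : Finset ι) (c : ι → K)
    (a : ι → G → K) (b : G → K) :
    quotientPairing N (∑ i ∈ s, c i • a i) b = ∑ i ∈ s, c i * quotientPairing N (a i) b := by
  have := Fintype.ofFinite (G ⧸ N)
  simp only [quotientPairing, finsum_eq_sum_of_fintype, Finset.sum_apply, Pi.smul_apply,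
    smul_eq_mul, Finset.sum_mul, Finset.mul_sum]
  rw [Finset.sum_comm]
  simp only [mul_assoc]

/-- Both representations descend to the finite group G/N, so the chosen coset representatives do not
matter and the orthogonality relation there applies. The index appears because the pairing is not
normalized. -/
theorem quotientPairing_character [Finite (G ⧸ N)] (hρ : ∀ g ∈ N, ρ g = 1)
    (hσ : ∀ g ∈ N, σ g = 1) : quotientPairing N σ.character ρ.character =
      (Nat.card (G ⧸ N) : K) * finrank K (IntertwiningMap ρ σ) := by
  have := Fintype.ofFinite (G ⧸ N)
  have h0 : (Nat.card (G ⧸ N) : K) ≠ 0 := by exact_mod_cast Nat.card_pos.ne'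
  have hinv : Invertible (Nat.card (G ⧸ N) : K) := invertibleOfNonzero h0
  have : IsTrivial (ρ.comp N.subtype) := ⟨fun g => hρ g g.2⟩
  have : IsTrivial (σ.comp N.subtype) := ⟨fun g => hσ g g.2⟩
  have key := card_inv_mul_sum_char_mul_char_eq_finrank (ofQuotient ρ N) (ofQuotient σ N)
  let e : IntertwiningMap (ofQuotient ρ N) (ofQuotient σ N) ≃ₗ[K] IntertwiningMap ρ σ :=
    { toFun := fun f => ⟨f.toLinearMap, fun g => f.isIntertwining' (g : G ⧸ N)⟩
      invFun := fun f => ⟨f.toLinearMap, fun q => by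
        obtain ⟨g, rfl⟩ := QuotientGroup.mk_surjective q
        exact f.isIntertwining' g⟩
      map_add' := fun _ _ => rfl
      map_smul' := fun _ _ => rfl
      left_inv := fun _ => rfl
      right_inv := fun _ => rfl }
  rw [e.finrank_eq] at key
  rw [← key, mul_inv_cancel_left₀ h0, quotientPairing, finsum_eq_sum_of_fintype]
  refine Finset.sum_congr rfl fun q _ => ?_
  have hq : ((q.out : G) : G ⧸ N) = q := QuotientGroup.out_eq' q
  have h1 : σ.character q.out = (ofQuotient σ N).character q := by
    conv_rhs => rw [← hq]
    rfl
  have h2 : ρ.character q.out⁻¹ = (ofQuotient ρ N).character q⁻¹ := by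
    conv_rhs => rw [← hq, ← QuotientGroup.mk_inv]
    rfl
  rw [h1, h2]

/-- The endomorphism algebra may be larger than K, but it contains the identity, so its dimension is
positive and hence nonzero in K. -/
theorem quotientPairing_self_ne_zero [Finite (G ⧸ N)] (hρ : ∀ g ∈ N, ρ g = 1) [Nontrivial V] :
    quotientPairing N ρ.character ρ.character ≠ 0 := by
  rw [quotientPairing_character N ρ ρ hρ hρ]
  have : Nontrivial (IntertwiningMap ρ ρ) := by
    refine ⟨IntertwiningMap.id ρ, 0, fun h => ?_⟩
    obtain ⟨v, hv⟩ := exists_ne (0 : V)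
    exact hv (congrArg (fun f : IntertwiningMap ρ ρ => f v) h)
  have : FiniteDimensional K (IntertwiningMap ρ ρ) :=
    FiniteDimensional.of_injective
      ({ toFun := fun f => f.toLinearMap, map_add' := fun _ _ => rfl, map_smul' := fun _ _ => rfl } :
        IntertwiningMap ρ ρ →ₗ[K] (V →ₗ[K] V))
      (IntertwiningMap.toLinearMap_injective ρ ρ)
  exact mul_ne_zero (by exact_mod_cast Nat.card_pos.ne')
    (by exact_mod_cast (finrank_pos (R := K) (M := IntertwiningMap ρ ρ)).ne')

/-- Schur's lemma: a nonzero intertwiner between irreducibles is bijective. -/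
theorem quotientPairing_eq_zero [Finite (G ⧸ N)] (hρ : ∀ g ∈ N, ρ g = 1)
    (hσ : ∀ g ∈ N, σ g = 1) [IsIrreducible ρ] [IsIrreducible σ] (h : IsEmpty (ρ.Equiv σ)) :
    quotientPairing N σ.character ρ.character = 0 := by
  rw [quotientPairing_character N ρ σ hρ hσ]
  have : Subsingleton (IntertwiningMap ρ σ) := by
    refine ⟨fun f g => ?_⟩
    suffices ∀ f : IntertwiningMap ρ σ, f = 0 by rw [this f, this g]
    intro f
    by_contra hf
    refine h.false (Representation.Equiv.mk (LinearEquiv.ofBijective f.toLinearMap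
      ⟨(IsIrreducible.injective_or_eq_zero f).resolve_right hf,
        (IsIrreducible.surjective_or_eq_zero f).resolve_right hf⟩) fun g => ?_)
    exact f.isIntertwining' g
  rw [finrank_zero_of_subsingleton, Nat.cast_zero, mul_zero]

end Orthogonality

/-! ### Injectivity of the character map -/

section Injectivity

variable {K : Type u} [Field K] [CharZero K] {G : Type v} [Group G] [TopologicalSpace G]

omit [CharZero K] in
theorem ArtinRep.exists_openSubgroup_forall_mem {ι : Type*} (s : Finset ι) (V : ι → ArtinRep K G) :
    ∃ U : OpenSubgroup G, ∀ i ∈ s, ∀ g ∈ U, (V i).obj.ρ g = 1 := by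
  classical
  induction s using Finset.induction_on with
  | empty => exact ⟨⊤, by simp⟩
  | insert i s _ ih =>
    obtain ⟨U, hU⟩ := ih
    obtain ⟨U', hU'⟩ := (V i).property
    refine ⟨U ⊓ U', fun j hj g hg => ?_⟩
    rcases Finset.mem_insert.1 hj with rfl | hj
    · exact hU' g hg.2
    · exact hU j hj g hg.1

variable [IsTopologicalGroup G] [CompactSpace G] [TotallyDisconnectedSpace G]

/-- Characters of pairwise nonisomorphic irreducible Artin representations are linearly
independent. -/
theorem linearIndependent_locChar {ι : Type*} (V : ι → ArtinRep K G)
    (hirr : ∀ i, (V i).rep.IsIrreducible) (hiso : ∀ i j, Nonempty (V i ≅ V j) → i = j) :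
    LinearIndependent K fun i => (V i).locChar := by
  rw [linearIndependent_iff']
  intro s c hc i hi
  -- A linear relation involves finitely many representations, so all of them factor through one
  -- finite quotient; pairing with the i-th character isolates `c i`.
  obtain ⟨U, hU⟩ := ArtinRep.exists_openSubgroup_forall_mem s V
  obtain ⟨N, hN⟩ := exists_openNormalSubgroup_le U
  have hc' : ∑ j ∈ s, c j • (V j).rep.character = 0 := by
    have := congrArg LocallyConstant.coeFnAddMonoidHom hc
    rw [map_sum, map_zero] at this
    exact this
  have h1 := quotientPairing_sum_smul N.toSubgroup s c (fun j => (V j).rep.character)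
    (V i).rep.character
  have hz : quotientPairing N.toSubgroup (0 : G → K) (V i).rep.character = 0 := by
    simp [quotientPairing]
  rw [hc', hz, Finset.sum_eq_single_of_mem i hi fun j hj hji => ?_] at h1
  · have : Nontrivial (V i).obj := by
      by_contra hnt
      have := not_nontrivial_iff_subsingleton.1 hnt
      have := hirr i
      exact bot_ne_top (α := Subrepresentation (V i).rep)
        (Subrepresentation.toSubmodule_injective (Subsingleton.elim _ _))
    exact (mul_eq_zero.1 h1.symm).resolve_right
      (quotientPairing_self_ne_zero _ _ fun g hg => hU i hi g (hN g hg))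
  · have := hirr i
    have := hirr j
    rw [quotientPairing_eq_zero N.toSubgroup (V i).obj.ρ (V j).obj.ρ
      (fun g hg => hU i hi g (hN g hg)) (fun g hg => hU j hj g (hN g hg)), mul_zero]
    exact ⟨fun e => hji (hiso i j ⟨ArtinRep.isoOfEquiv e⟩).symm⟩

variable (K G) in
-- A linear map that sends a spanning family to a linearly independent one is injective. The family
-- has one member for each isomorphism class of irreducibles.
theorem tensorChar_injective : Function.Injective (tensorChar K G) := by
  let I := {s : Skeleton (ArtinRep K G) //
    ∃ V : ArtinRep K G, V.rep.IsIrreducible ∧ toSkeleton V = s}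
  choose V hirr hV using fun i : I => i.2
  have hind := linearIndependent_locChar V hirr fun i j ⟨e⟩ => Subtype.ext (by
    rw [← hV i, ← hV j, congr_toSkeleton_of_iso e])
  let w : I → K ⊗[ℤ] ArtinK0 K G := fun i => 1 ⊗ₜ (V i).cls
  have hspan : Submodule.span K (Set.range w) = ⊤ := by
    rw [eq_top_iff, ← span_tmul_of_closure_eq_top closure_cls_irreducible, Submodule.span_le]
    rintro _ ⟨_, ⟨S, hS, rfl⟩, rfl⟩
    refine Submodule.subset_span ⟨⟨toSkeleton S, S, hS, rfl⟩, ?_⟩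
    change (1 : K) ⊗ₜ[ℤ] ArtinRep.cls _ = _
    rw [ArtinRep.cls, freeClass, hV]
    rfl
  have hcomp : (tensorChar K G).toLinearMap ∘ₗ Finsupp.linearCombination K w =
      Finsupp.linearCombination K fun i => (V i).locChar := by
    ext1 i
    ext
    simp [w, tensorChar_tmul_cls]
  refine Function.Injective.of_comp_right (g := Finsupp.linearCombination K w) ?_
    (LinearMap.range_eq_top.1 (by rw [Finsupp.range_linearCombination, hspan]))
  have : Function.Injective ((tensorChar K G).toLinearMap ∘ₗ Finsupp.linearCombination K w) := by
    rw [hcomp]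
    exact hind
  exact this

end Injectivity

/-! ### Subalgebras of functions on a finite set -/

section Interpolation

/-- On a finite set, a subalgebra of functions contains every function that is constant on the
classes that the subalgebra does not separate. -/
theorem Subalgebra.mem_of_forall_eq_of_finite {K X : Type*} [Field K] [Finite X]
    (A : Subalgebra K (X → K)) (f : X → K)
    (hf : ∀ x y, (∀ a ∈ A, a x = a y) → f x = f y) : f ∈ A := by
  classical
  let s : Setoid X := ⟨fun x y => ∀ a ∈ A, a x = a y, fun _ _ _ => rfl,
    fun h a ha => (h a ha).symm, fun h h' a ha => (h a ha).trans (h' a ha)⟩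
  have hout : ∀ x, ∀ a ∈ A, a (Quotient.mk s x).out = a x := fun x => Quotient.mk_out (s := s) x
  have := Fintype.ofFinite (Quotient s)
  have hsep : ∀ y z : Quotient s, y ≠ z → ∃ a ∈ A, a y.out ≠ a z.out := by
    intro y z hyz
    by_contra! h
    exact hyz (by rw [← Quotient.out_eq y, ← Quotient.out_eq z]; exact Quotient.sound h)
  choose! a ha hne using hsep
  -- Lagrange interpolation: the factor for z vanishes on the class z and equals 1 on the class y,
  -- so `e y` is the indicator function of the class y.
  let e : Quotient s → X → K := fun y => ∏ z ∈ Finset.univ.erase y,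
    (a y z - algebraMap K _ (a y z z.out)) * algebraMap K _ (a y z y.out - a y z z.out)⁻¹
  have he : ∀ y, e y ∈ A := fun y => Subalgebra.prod_mem _ fun z hz =>
    mul_mem (sub_mem (ha y z (Finset.ne_of_mem_erase hz).symm) (A.algebraMap_mem _))
      (A.algebraMap_mem _)
  have hself : ∀ y, e y y.out = 1 := by
    intro y
    simp only [e, Finset.prod_apply]
    refine Finset.prod_eq_one fun z hz => ?_
    exact mul_inv_cancel₀ (sub_ne_zero.2 (hne y z (Finset.ne_of_mem_erase hz).symm))
  have hother : ∀ y z, y ≠ z → e y z.out = 0 := by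
    intro y z hyz
    simp only [e, Finset.prod_apply]
    refine Finset.prod_eq_zero (Finset.mem_erase.2 ⟨hyz.symm, Finset.mem_univ z⟩) ?_
    simp
  have hsum : f = ∑ y, f y.out • e y := by
    ext x
    rw [Finset.sum_apply, Finset.sum_eq_single (Quotient.mk s x)]
    · rw [Pi.smul_apply, smul_eq_mul, ← hout x _ (he _), hself, mul_one]
      exact (hf _ _ (hout x)).symm
    · intro y _ hy
      rw [Pi.smul_apply, ← hout x _ (he _), hother y _ hy, smul_zero]
    · exact fun h => absurd (Finset.mem_univ _) h
  rw [hsum]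
  exact sum_mem fun y _ => A.smul_mem (he y) _

end Interpolation

/-! ### Permutation characters -/

section PermutationRepresentation

variable (K : Type u) [Field K] {G : Type v} [Group G] {n : ℕ} (π : G →* Equiv.Perm (Fin n))

/-- The permutation representation of an action on `Fin n`. -/
def permRep : Representation K G (Fin n → K) where
  -- Precomposition reverses products; the inverse restores the order.
  toFun g := LinearMap.funLeft K K (π g⁻¹)
  map_one' := by ext; simp [LinearMap.funLeft]
  map_mul' g h := by ext; simp [LinearMap.funLeft]

/-- The trace counts fixed points, and characteristic 0 keeps a positive count nonzero. -/
theorem trace_permRep_ne_zero_iff [CharZero K] (g : G) :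
    LinearMap.trace K _ (permRep K π g) ≠ 0 ↔ ∃ i, π g i = i := by
  classical
  have h1 : LinearMap.trace K _ (permRep K π g) =
      ((Finset.univ.filter fun i => π g i = i).card : K) := by
    rw [LinearMap.trace_eq_matrix_trace K (Pi.basisFun K (Fin n)), Matrix.trace,
      Finset.card_filter, Nat.cast_sum]
    refine Finset.sum_congr rfl fun i _ => ?_
    have : π g⁻¹ i = i ↔ π g i = i := by
      rw [map_inv, Equiv.Perm.inv_eq_iff_eq, eq_comm]
    simp [permRep, LinearMap.funLeft, Pi.single_apply, ← this]
  rw [h1, Nat.cast_ne_zero, Finset.card_ne_zero]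
  simp [Finset.Nonempty]

end PermutationRepresentation

/-! ### Conjugate cyclic subgroups of a p-group -/

section CyclicSubgroups

variable {p : ℕ} [hpr : Fact p.Prime] {Q : Type*} [Group Q] [Finite Q]

/-- In a finite `p`-group, elements that generate conjugate cyclic subgroups are related by a power
prime to `p` and conjugation. -/
theorem exists_conj_pow_of_isPGroup (hQ : IsPGroup p Q) {x y q r : Q}
    (hy : q⁻¹ * y * q ∈ Subgroup.zpowers x) (hx : r⁻¹ * x * r ∈ Subgroup.zpowers y) :
    ∃ k : ℕ, k.Coprime p ∧ y = q * x ^ k * q⁻¹ := by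
  have hord : ∀ a b : Q, orderOf (b⁻¹ * a * b) = orderOf a := fun a b => by
    have := MulAut.conj b⁻¹ |>.orderOf_eq a
    simpa using this
  have h1 : orderOf y ∣ orderOf x := by
    rw [← hord y q]
    exact orderOf_dvd_of_mem_zpowers hy
  have h2 : orderOf x ∣ orderOf y := by
    rw [← hord x r]
    exact orderOf_dvd_of_mem_zpowers hx
  rw [← mem_powers_iff_mem_zpowers] at hy
  obtain ⟨k, hk⟩ := hy
  change x ^ k = _ at hk
  have hyk : ∀ z : Q, z = q⁻¹ * y * q → y = q * z * q⁻¹ := by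
    rintro z rfl
    group
  -- The orders of x and y divide each other, so xᵏ, a conjugate of y, has the same order as x.
  have hgcd : (orderOf x).Coprime k := by
    have h3 := orderOf_pow x (n := k)
    rw [hk, hord, Nat.dvd_antisymm h1 h2] at h3
    have hpos := orderOf_pos x
    have h4 := Nat.div_mul_cancel (Nat.gcd_dvd_left (orderOf x) k)
    rw [← h3] at h4
    exact Nat.eq_of_mul_eq_mul_left hpos (by rw [h4, mul_one])
  obtain ⟨m, hm⟩ := (IsPGroup.iff_orderOf.1 hQ) x
  cases m with
  -- For x = 1, coprimality to the order says nothing about `k`, so the exponent 1 is used instead.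
  | zero =>
    rw [pow_zero, orderOf_eq_one_iff] at hm
    refine ⟨1, Nat.coprime_one_left p, hyk _ ?_⟩
    rw [← hk, hm, one_pow, one_pow]
  | succ m =>
    rw [hm] at hgcd
    exact ⟨k, ((Nat.coprime_pow_left_iff m.succ_pos _ _).1 hgcd).symm, hyk _ hk⟩

end CyclicSubgroups

/-! ### Surjectivity onto the invariant functions -/

section Surjectivity

variable {p : ℕ} [Fact p.Prime] {K : Type u} [Field K] [CharZero K] {G : Type v} [Group G]
  [TopologicalSpace G] [IsTopologicalGroup G]

omit [CharZero K] in
variable (K) in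
/-- Functions on a finite quotient as locally constant functions. -/
def inflate (N : OpenNormalSubgroup G) : (G ⧸ N.toSubgroup → K) →ₐ[K] LocallyConstant G K where
  toFun a :=
    { toFun := fun g => a g
      isLocallyConstant := (IsLocallyConstant.iff_exists_open _).2 fun g =>
        ⟨(fun x => g⁻¹ * x) ⁻¹' N, N.toOpenSubgroup.isOpen.preimage (continuous_const_mul _),
          by
            change g⁻¹ * g ∈ N.toSubgroup
            simp,
          fun x hx => congrArg a (QuotientGroup.eq.2 hx).symm⟩ }
  map_one' := rfl
  map_mul' _ _ := rfl
  map_zero' := rfl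
  map_add' _ _ := rfl
  commutes' _ := rfl

/-- With Q = G/N, take the permutation character of Q on Q/⟨c⟩: y fixes the coset q⟨c⟩ exactly when
q⁻¹yq ∈ ⟨c⟩. -/
theorem exists_permutation_character (N : OpenNormalSubgroup G) [Finite (G ⧸ N.toSubgroup)]
    (c : G ⧸ N.toSubgroup) :
    ∃ a : G ⧸ N.toSubgroup → K, inflate K N a ∈ (tensorChar K G).range ∧
      ∀ y, a y ≠ 0 ↔ ∃ q, q⁻¹ * y * q ∈ Subgroup.zpowers c := by
  -- Numbering the cosets by `Fin` puts the representation space in the universe of `K`, as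
  -- `ArtinRep` requires.
  let e := Finite.equivFin ((G ⧸ N.toSubgroup) ⧸ Subgroup.zpowers c)
  let π : G ⧸ N.toSubgroup →* Equiv.Perm (Fin _) := e.permCongrHom.toMonoidHom.comp
    (MulAction.toPermHom (G ⧸ N.toSubgroup) ((G ⧸ N.toSubgroup) ⧸ Subgroup.zpowers c))
  let V : ArtinRep K G := ArtinRep.ofRep ((permRep K π).comp (QuotientGroup.mk' N.toSubgroup))
    ⟨N.toOpenSubgroup, fun g hg => by
      have : QuotientGroup.mk' N.toSubgroup g = 1 := (QuotientGroup.eq_one_iff g).2 hg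
      rw [MonoidHom.comp_apply, this, map_one]⟩
  refine ⟨fun y => LinearMap.trace K _ (permRep K π y), ⟨1 ⊗ₜ V.cls, ?_⟩, fun y => ?_⟩
  · change tensorChar K G (1 ⊗ₜ V.cls) = _
    rw [tensorChar_tmul_cls, one_smul]
    rfl
  · rw [trace_permRep_ne_zero_iff]
    have hπ : ∀ z : (G ⧸ N.toSubgroup) ⧸ Subgroup.zpowers c, π y (e z) = e (y • z) := fun z => by
      simp [π, Equiv.permCongrHom]
    rw [← e.exists_congr_right]
    simp only [hπ, e.apply_eq_iff_eq]
    rw [(QuotientGroup.mk_surjective).exists]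
    refine exists_congr fun q => ?_
    rw [eq_comm]
    change ((q : (G ⧸ N.toSubgroup) ⧸ Subgroup.zpowers c) = ((y * q : G ⧸ N.toSubgroup) : _)) ↔ _
    rw [QuotientGroup.eq, mul_assoc]

variable [CompactSpace G] [TotallyDisconnectedSpace G] [IsProP p G]

omit [CharZero K] in
theorem apply_conj_padicPow_of_mem_invariantFunctions {f : LocallyConstant G K}
    (hf : f ∈ invariantFunctions p K G) (σ : CycloGal p K) (h x : G) :
    f (h * padicPow p x (cycloChar p K σ : ℤ_[p]) * h⁻¹) = f x := by
  have := hf (h, σ)⁻¹ x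
  rw [inv_inv] at this
  exact this

theorem mem_range_tensorChar (hirr : ∀ n, Irreducible (Polynomial.cyclotomic (p ^ n) K))
    {f : LocallyConstant G K} (hf : f ∈ invariantFunctions p K G) :
    f ∈ (tensorChar K G).range := by
  obtain ⟨N, hN⟩ := exists_openNormalSubgroup_factor f
  let F : G ⧸ N.toSubgroup → K := fun q => f q.out
  have hF : ∀ g : G, F g = f g := fun g => hN _ _ (QuotientGroup.out_eq' _)
  have hinf : inflate K N F = f := LocallyConstant.ext hF
  rw [← hinf]
  -- It remains to show that `F` agrees at any x, y that this algebra does not separate.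
  refine Subalgebra.mem_of_forall_eq_of_finite ((tensorChar K G).range.comap (inflate K N)) F
    fun x y hxy => ?_
  obtain ⟨a, ha, ha'⟩ := exists_permutation_character (K := K) N x
  obtain ⟨b, hb, hb'⟩ := exists_permutation_character (K := K) N y
  -- x lies in ⟨x⟩, so `a` is nonzero at x and therefore at y: y is conjugate into ⟨x⟩. The same
  -- argument with `b` exchanges x and y.
  obtain ⟨q, hq⟩ := (ha' y).1 (by
    rw [← hxy a ha]
    exact (ha' x).2 ⟨1, by simp⟩)
  obtain ⟨r, hr⟩ := (hb' x).1 (by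
    rw [hxy b hb]
    exact (hb' y).2 ⟨1, by simp⟩)
  obtain ⟨k, hk, hy⟩ := exists_conj_pow_of_isPGroup (IsProP.isPGroup_quotient (p := p) N) hq hr
  obtain ⟨x, rfl⟩ := QuotientGroup.mk_surjective x
  obtain ⟨h, rfl⟩ := QuotientGroup.mk_surjective q
  -- Since x ^ pᵐ = 1 in the quotient, only χ(σ) mod pᵐ matters, and it can be made equal to k.
  obtain ⟨m, hm⟩ := exists_pow_mem (p := p) N x
  obtain ⟨σ, hσ⟩ := exists_cycloChar_toZModPow_eq (hirr m) hk
  rw [← mk_padicPow hm hσ, ← QuotientGroup.mk_inv, ← QuotientGroup.mk_mul,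
    ← QuotientGroup.mk_mul] at hy
  rw [hy, hF, hF, apply_conj_padicPow_of_mem_invariantFunctions hf]

end Surjectivity

end

theorem mainTheorem12
    (p : ℕ) [Fact p.Prime]
    (R : Type*) [CommRing R] [IsDomain R] [IsDiscreteValuationRing R]
    [IsAdicComplete (IsLocalRing.maximalIdeal R) R] (hp : Irreducible (p : R))
    (K : Type*) [Field K] [CharZero K] [Algebra R K] [IsFractionRing R K]
    (G : Type*) [Group G] [TopologicalSpace G] [IsTopologicalGroup G]
    [CompactSpace G] [TotallyDisconnectedSpace G] [IsProP p G] :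
    ∃ Φ : (K ⊗[ℤ] ArtinK0 K G) ≃ₐ[K] invariantFunctions p K G,
      ∀ (c : K) (V : ArtinRep K G) (g : G),
        (Φ (c ⊗ₜ[ℤ] V.cls) : LocallyConstant G K) g = c * V.obj.character g := by
  refine ⟨AlgEquiv.ofBijective ((tensorChar K G).codRestrict (invariantFunctions p K G)
    (tensorChar_mem_invariantFunctions p K G)) ⟨fun x y hxy => ?_, fun f => ?_⟩, fun c V g => ?_⟩
  · exact tensorChar_injective K G (congrArg Subtype.val hxy)
  · obtain ⟨x, hx⟩ := mem_range_tensorChar (cyclotomic_prime_pow_irreducible hp K) f.2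
    exact ⟨x, Subtype.ext hx⟩
  · exact congrArg (fun f : LocallyConstant G K => f g) (tensorChar_tmul_cls c V)
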